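/- Let $s=\{\xi\in\mathbb C^{\mathbb N}: |\xi|_q=(\sum_{j\ge1}|\xi_j|^2j^{2q})^{1/2}<\infty\text{ for all }q\in\mathbb N_0\}$ be the Fréchet space of rapidly decreasing sequences, with the topology given by the norms $|\cdot|_q$, and let $s'=\{\xi\in\mathbb C^{\mathbb N}: |\xi|'_q=(\sum_{j\ge1}|\xi_j|^2j^{-2q})^{1/2}<\infty\text{ for some }q\in\mathbb N_0\}$, with the locally convex inductive limit topology given by the norms $|\cdot|'_q$. Let $L(s',s)$ be the algebra of continuous linear operators $s'\to s$, with the topology given by the norms $\|x\|_q=\sup_{|\xi|'_q\le1}|x\xi|_q$ $(q\in\mathbb N_0)$ and the product $xy=x\circ j\circ y$, where $j:s\hookrightarrow s'$ is the inclusion. Through $\ell_2\hookrightarrow s'\to s\hookrightarrow\ell_2$, every element of $L(s',s)$ is regarded as a bounded operator on $\ell_2$; the involution $x\mapsto x^*$ is the Hilbert space adjoint, and a projection in $L(s',s)$ is an element which is an orthogonal (self-adjoint) projection on $\ell_2$. Let $A$ be a commutative subalgebra (not necessarily unital, closed or self-adjoint) of $L(s',s)$. Let $\mathcal P$ be the set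 of nonzero projections belonging to $A$ and let $\mathcal M$ be the set of minimal elements of $\mathcal P$ with respect to the order relation $P\preceq Q\Leftrightarrow PQ=QP=P$. Then: (i) $\mathcal M$ is at most countable, $PQ=0$ for all distinct $P,Q\in\mathcal M$, and every $P\in\mathcal P$ is the sum of finitely many distinct elements of $\mathcal M$. (ii) If $A$ is moreover closed in $L(s',s)$ and $x^*\in A$ for every $x\in A$, then $\mathcal M$ is a Schauder basis of $A$: for every enumeration $(P_n)_{n<N}$, $N\in\mathbb N_0\cup\{\infty\}$, of $\mathcal M$ without repetition, every $x\in A$ has exactly one expansion $x=\sum_{n<N}c_nP_n$ with $c_n\in\mathbb C$ and with partial sums converging in $L(s',s)$, and the coefficients $c_n$ are continuous linear functionals of $x\in A$. -/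

import Mathlib

open Filter Topology

noncomputable section

namespace SmoothOperators

/-- The complex Hilbert space `ℓ₂`. -/
abbrev L2 : Type := lp (fun _ : ℕ => ℂ) 2

/-- The weights `1, 2^q, 3^q, …`; the `j`-th coordinate (`j = 1, 2, …`) of a sequence has index
`j - 1` in `ℕ`. -/
def weight (q j : ℕ) : ℂ := ((j + 1 : ℕ) : ℂ) ^ q

theorem weight_ne_zero (q j : ℕ) : weight q j ≠ 0 :=
  pow_ne_zero _ (Nat.cast_ne_zero.mpr (Nat.succ_ne_zero j))

/-! ### The space `s` of rapidly decreasing sequences -/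

/-- The sequences `ξ` with `∑ |ξ_j|² j^{2q} < ∞` for all `q`. -/
def sSubmodule : Submodule ℂ (ℕ → ℂ) where
  carrier := {ξ | ∀ q, Memℓp (fun j => weight q j * ξ j) 2}
  zero_mem' := fun q => by
    have h : (fun j => weight q j * (0 : ℕ → ℂ) j) = fun _ => (0 : ℂ) := by ext j; simp
    rw [h]; exact zero_memℓp
  add_mem' := fun {a b} ha hb q => by
    have h : (fun j => weight q j * (a + b) j)
        = (fun j => weight q j * a j) + fun j => weight q j * b j := by
      ext j; simp [mul_add]
    rw [h]; exact (ha q).add (hb q)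
  smul_mem' := fun c a ha q => by
    have h : (fun j => weight q j * (c • a) j) = c • fun j => weight q j * a j := by
      ext j; simp only [Pi.smul_apply, smul_eq_mul]; ring
    rw [h]; exact (ha q).const_smul c

/-- The space `s` of rapidly decreasing sequences. -/
def S : Type := sSubmodule

namespace S

instance : AddCommGroup S := inferInstanceAs (AddCommGroup sSubmodule)
instance : Module ℂ S := inferInstanceAs (Module ℂ sSubmodule)

/-- The linear map `s → ℓ₂`, `ξ ↦ (ξ_j j^q)_j`. -/
def toL2 (q : ℕ) : S →ₗ[ℂ] L2 where
  toFun ξ := ⟨fun j => weight q j * ξ.1 j, ξ.2 q⟩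
  map_add' a b := by
    ext j
    change weight q j * (a.1 j + b.1 j) = weight q j * a.1 j + weight q j * b.1 j
    ring
  map_smul' c a := by
    ext j
    change weight q j * (c * a.1 j) = c * (weight q j * a.1 j)
    ring

/-- The norms `|ξ|_q = (∑ |ξ_j|² j^{2q})^{1/2} = ‖(ξ_j j^q)_j‖_{ℓ₂}` of `s`. -/
def seminorms : SeminormFamily ℂ S ℕ := fun q => (normSeminorm ℂ L2).comp (toL2 q)

/-- The topology of `s`, given by the norms `|·|_q`. -/
instance : TopologicalSpace S := seminorms.moduleFilterBasis.topology

theorem withSeminorms : WithSeminorms seminorms := ⟨rfl⟩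

instance : IsTopologicalAddGroup S := withSeminorms.topologicalAddGroup
instance : ContinuousSMul ℂ S := withSeminorms.continuousSMul

/-- The continuous linear map `s → ℓ₂`, `ξ ↦ (ξ_j j^q)_j`. For `q = 0` it is the inclusion. -/
def toL2L (q : ℕ) : S →L[ℂ] L2 where
  toLinearMap := toL2 q
  cont := withSeminorms.continuous_normedSpace_rng L2 _
    ⟨{q}, 1, by rw [Finset.sup_singleton, one_smul]; exact le_rfl⟩

end S

/-! ### The space `s'` of slowly increasing sequences -/

/-- The sequences `ξ` with `∑ |ξ_j|² j^{-2q} < ∞` for some `q`. -/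
def sDualSubmodule : Submodule ℂ (ℕ → ℂ) where
  carrier := {ξ | ∃ q, Memℓp (fun j => (weight q j)⁻¹ * ξ j) 2}
  zero_mem' := ⟨0, by
    have h : (fun j => (weight 0 j)⁻¹ * (0 : ℕ → ℂ) j) = fun _ => (0 : ℂ) := by ext j; simp
    rw [h]; exact zero_memℓp⟩
  add_mem' := by
    have mono : ∀ (ξ : ℕ → ℂ) (q p : ℕ), Memℓp (fun j => (weight q j)⁻¹ * ξ j) 2 →
        Memℓp (fun j => (weight (q + p) j)⁻¹ * ξ j) 2 := by
      intro ξ q p h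
      have h2 : 0 < (2 : ENNReal).toReal := by norm_num
      refine memℓp_gen (Summable.of_nonneg_of_le (fun j => by positivity) (fun j => ?_)
        (h.summable h2))
      refine Real.rpow_le_rpow (norm_nonneg _) ?_ h2.le
      rw [norm_mul, norm_mul, norm_inv, norm_inv]
      refine mul_le_mul_of_nonneg_right ?_ (norm_nonneg _)
      simp only [weight, norm_pow, Complex.norm_natCast]
      have h1 : (1 : ℝ) ≤ ((j + 1 : ℕ) : ℝ) := by exact_mod_cast Nat.succ_pos j
      exact inv_anti₀ (by positivity) (pow_le_pow_right₀ h1 (Nat.le_add_right q p))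
    rintro a b ⟨p, ha⟩ ⟨q, hb⟩
    refine ⟨p + q, ?_⟩
    have h : (fun j => (weight (p + q) j)⁻¹ * (a + b) j)
        = (fun j => (weight (p + q) j)⁻¹ * a j) + fun j => (weight (p + q) j)⁻¹ * b j := by
      ext j; simp [mul_add]
    rw [h]
    exact (mono a p q ha).add (by rw [Nat.add_comm p q]; exact mono b q p hb)
  smul_mem' := fun c a ⟨q, ha⟩ => ⟨q, by
    have h : (fun j => (weight q j)⁻¹ * (c • a) j) = c • fun j => (weight q j)⁻¹ * a j := by
      ext j; simp only [Pi.smul_apply, smul_eq_mul]; ring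
    rw [h]; exact ha.const_smul c⟩

/-- The space `s'` of slowly increasing sequences. -/
def SDual : Type := sDualSubmodule

namespace SDual

instance : AddCommGroup SDual := inferInstanceAs (AddCommGroup sDualSubmodule)
instance : Module ℂ SDual := inferInstanceAs (Module ℂ sDualSubmodule)

/-- The linear map `ℓ₂ → s'`, `η ↦ (η_j j^q)_j`. It is an isometry of `ℓ₂` onto the step
`{ξ : |ξ|'_q < ∞}` of `s'`, where `|ξ|'_q = (∑ |ξ_j|² j^{-2q})^{1/2}`. -/
def ofL2 (q : ℕ) : L2 →ₗ[ℂ] SDual where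
  toFun η := ⟨fun j => weight q j * η j, q, by
    have h : (fun j => (weight q j)⁻¹ * (weight q j * η j)) = η := by
      ext j; exact inv_mul_cancel_left₀ (weight_ne_zero q j) _
    rw [h]; exact lp.memℓp η⟩
  map_add' a b := Subtype.ext <| funext fun j => by
    change weight q j * (a j + b j) = weight q j * a j + weight q j * b j
    ring
  map_smul' c a := Subtype.ext <| funext fun j => by
    change weight q j * (c * a j) = c * (weight q j * a j)
    ring

/-- The locally convex inductive limit topology of `s'`: the finest locally convex vector space
topology for which the inclusions of the steps `{ξ : |ξ|'_q < ∞}` (normed by `|·|'_q`, and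
identified with `ℓ₂` through `ofL2 q`) are continuous. -/
instance : TopologicalSpace SDual :=
  sInf {t | @IsTopologicalAddGroup SDual t _ ∧ @ContinuousSMul ℂ SDual _ _ t ∧
    @LocallyConvexSpace ℝ SDual _ _ _ _ t ∧ ∀ q, @Continuous L2 SDual _ t (ofL2 q)}

/-- The continuous linear map `ℓ₂ → s'`, `η ↦ (η_j j^q)_j`. For `q = 0` it is the inclusion. -/
def ofL2L (q : ℕ) : L2 →L[ℂ] SDual where
  toLinearMap := ofL2 q
  cont := continuous_sInf_rng.mpr fun _ ht => ht.2.2.2 q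

end SDual

/-- The canonical continuous inclusion `s → s'`. -/
def inclusion : S →L[ℂ] SDual where
  toFun ξ := ⟨ξ.1, 0, by
    have h := ξ.2 0
    simpa only [weight, pow_zero, inv_one] using h⟩
  map_add' _ _ := rfl
  map_smul' _ _ := rfl
  cont := by
    refine ((SDual.ofL2L 0).comp (S.toL2L 0)).continuous.congr fun ξ => ?_
    refine Subtype.ext (funext fun j => ?_)
    change weight 0 j * (weight 0 j * ξ.1 j) = ξ.1 j
    simp [weight]

/-! ### The algebra `L(s', s)` of smooth operators -/

/-- The space `L(s', s)` of continuous linear operators from `s'` to `s`. -/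
def SmoothOp : Type := SDual →L[ℂ] S

namespace SmoothOp

instance : AddCommGroup SmoothOp := inferInstanceAs (AddCommGroup (SDual →L[ℂ] S))
instance : Module ℂ SmoothOp := inferInstanceAs (Module ℂ (SDual →L[ℂ] S))

/-- An element of `L(s', s)` as a continuous linear map. -/
def toCLM : SmoothOp →ₗ[ℂ] (SDual →L[ℂ] S) := LinearMap.id

/-- The product `x · y = x ∘ j ∘ y`, where `j : s → s'` is the inclusion. -/
instance : Mul SmoothOp := ⟨fun x y => x.toCLM.comp (inclusion.comp y.toCLM)⟩

theorem mul_apply (x y : SmoothOp) (ξ : SDual) :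
    (x * y).toCLM ξ = x.toCLM (inclusion (y.toCLM ξ)) := rfl

@[ext] theorem ext {x y : SmoothOp} (h : ∀ ξ, x.toCLM ξ = y.toCLM ξ) : x = y :=
  ContinuousLinearMap.ext h

instance : NonUnitalRing SmoothOp where
  left_distrib x y z := by
    ext ξ; simp only [mul_apply, map_add, add_apply]
  right_distrib x y z := by
    ext ξ; simp only [mul_apply, map_add, add_apply]
  zero_mul x := by
    ext ξ; simp only [mul_apply, map_zero, zero_apply]
  mul_zero x := by
    ext ξ; simp only [mul_apply, map_zero, zero_apply]
  mul_assoc x y z := rfl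

instance : IsScalarTower ℂ SmoothOp SmoothOp := ⟨fun c x y => by
  ext ξ; simp only [smul_eq_mul, mul_apply, map_smul, smul_apply]⟩

instance : SMulCommClass ℂ SmoothOp SmoothOp := ⟨fun c x y => by
  ext ξ; simp only [smul_eq_mul, mul_apply, map_smul, smul_apply]⟩

/-- The linear map sending `x ∈ L(s', s)` to the bounded operator
`ℓ₂ → s' → s → ℓ₂`, `η ↦ (j^q (x (k^q η_k)_k)_j)_j`. -/
def sandwich (q : ℕ) : SmoothOp →ₗ[ℂ] (L2 →L[ℂ] L2) where
  toFun x := (S.toL2L q).comp (x.toCLM.comp (SDual.ofL2L q))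
  map_add' x y := by
    ext1 η; simp only [map_add, ContinuousLinearMap.comp_apply, add_apply]
  map_smul' c x := by
    ext1 η
    simp only [map_smul, ContinuousLinearMap.comp_apply, smul_apply,
      RingHom.id_apply]

/-- The canonical embedding of `L(s', s)` into `L(ℓ₂)`, given by `ℓ₂ ↪ s' → s ↪ ℓ₂`. -/
def toL2 (x : SmoothOp) : L2 →L[ℂ] L2 := sandwich 0 x

/-- The norms `‖x‖_q = sup {|x ξ|_q : |ξ|'_q ≤ 1}`. Since `ofL2 q` is an isometry of `ℓ₂` onto
`({ξ : |ξ|'_q < ∞}, |·|'_q)` and `|ζ|_q = ‖S.toL2 q ζ‖`, this is the operator norm of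
`sandwich q x`. -/
def seminorms : SeminormFamily ℂ SmoothOp ℕ :=
  fun q => (normSeminorm ℂ (L2 →L[ℂ] L2)).comp (sandwich q)

/-- The topology of `L(s', s)`, given by the norms `‖·‖_q`. -/
instance : TopologicalSpace SmoothOp := seminorms.moduleFilterBasis.topology

end SmoothOp

/-! ### Projections in a subalgebra -/

/-- A subalgebra of `L(s', s)` is a `*`-subalgebra if it contains, with every `x`, its Hilbert
space adjoint `x*`. -/
def IsStarSubalgebra (A : NonUnitalSubalgebra ℂ SmoothOp) : Prop :=
  ∀ x ∈ A, ∃ y ∈ A, y.toL2 = ContinuousLinearMap.adjoint x.toL2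

/-- The nonzero orthogonal (self-adjoint) projections of `ℓ₂` that belong to `A`. -/
def projections (A : NonUnitalSubalgebra ℂ SmoothOp) : Set A :=
  {P | P ≠ 0 ∧ IsStarProjection (P : SmoothOp).toL2}

/-- The order relation `P ≼ Q ↔ PQ = QP = P`. -/
def ProjLE {A : NonUnitalSubalgebra ℂ SmoothOp} (P Q : A) : Prop := P * Q = P ∧ Q * P = P

/-- The minimal elements of the set of nonzero projections in `A`. -/
def minimalProjections (A : NonUnitalSubalgebra ℂ SmoothOp) : Set A :=
  {P | P ∈ projections A ∧ ∀ Q ∈ projections A, ProjLE Q P → Q = P}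

/-! ### Schauder bases -/

/-- `x = ∑ c_i b_i`, as a series with the terms taken in the order given by an enumeration
(that is, an injective map `rank : ι → ℕ`) of the at most countable index set `ι`: the partial
sums over `{i : rank i < n}` converge to `x`. -/
def IsExpansion {ι E : Type*} [AddCommGroup E] [Module ℂ E] [TopologicalSpace E]
    (rank : ι ↪ ℕ) (b : ι → E) (c : ι → ℂ) (x : E) : Prop :=
  Tendsto (fun n => ∑ i ∈ (Finset.range n).preimage rank rank.injective.injOn, c i • b i)
    atTop (𝓝 x)

/-- A finite or infinite sequence `(b_i)`, with the order of its terms given by `rank`, is a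
Schauder basis of `E`: every `x` has exactly one expansion `x = ∑ c_i b_i`, and the coefficients
`c_i` are continuous linear functionals of `x`. -/
def IsSchauderBasis {ι E : Type*} [AddCommGroup E] [Module ℂ E] [TopologicalSpace E]
    (rank : ι ↪ ℕ) (b : ι → E) : Prop :=
  (∀ x : E, ∃! c : ι → ℂ, IsExpansion rank b c x) ∧
    ∃ coord : ι → (E →L[ℂ] ℂ), ∀ x : E, IsExpansion rank b (fun i => coord i x) x

end SmoothOperators

end

/-! An element `x` of `L(s', s)` extends to weighted sequences, so the columns `x e_j` decrease
rapidly in `ℓ₂`. Hence `x` is compact on `ℓ₂`, and every projection has finite rank. In a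
commutative algebra the product of two projections is again a projection, so distinct minimal ones
annihilate each other. Countability comes from the separability of `ℓ₂`, and the finite
decompositions from induction on the rank (`exists_sum_minimal`).

For a closed `*`-subalgebra the key is `exists_top_projection`. If `g` is self-adjoint of norm one,
the powers of `g²` converge in norm to the nonzero projection `p` onto `ker (g² - 1)`. Since `p = g²
p g²` and `T ↦ g² T g²` is continuous from `L(ℓ₂)` to `L(s', s)`, `p` lies in `A`. Consequently:
minimal projections reduce every `x` to a scalar (`exists_mul_minimal_eq_smul`); the norm of `x - x
S_n`, where `S_n` is the `n`-th partial sum of minimal projections, is attained on a projection that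
later partial sums contain, so the Cauchy sequence `x S_n` has limit `x` in operator norm
(`tendsto_norm_op_sub`).

Finally `|ζ|_q² ≤ |ζ|_{2q} |ζ|_0`, applied to columns, upgrades this to every norm `‖·‖_q`
(`tendsto_mul_partialSum`). Uniqueness follows from the functionals `x ↦ ⟨v, x v⟩`, with `v` a unit
vector in the range of a minimal projection. -/

namespace SmoothOperators

/-! ### Operators on `ℓ₂` and their columns -/

/-- The standard unit vectors of `ℓ₂`. -/
noncomputable def unitVec (j : ℕ) : L2 := lp.single 2 j (1 : ℂ)

theorem norm_unitVec (j : ℕ) : ‖unitVec j‖ = 1 := by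
  rw [unitVec, lp.norm_single (by norm_num), norm_one]

section Columns

variable {E : Type*} [NormedAddCommGroup E] [NormedSpace ℂ E]

theorem hasSum_unitVec (η : L2) : HasSum (fun j => η j • unitVec j) η := by
  have h := lp.hasSum_single (p := 2) (by norm_num) η
  convert h using 2 with j
  rw [unitVec, ← lp.single_smul, smul_eq_mul, mul_one]

theorem clm_eq_zero_of_unitVec {F : Type*} [AddCommGroup F] [Module ℂ F] [TopologicalSpace F]
    [T2Space F] (T : L2 →L[ℂ] F) (h : ∀ j, T (unitVec j) = 0) : T = 0 := by
  ext η
  have h1 := (hasSum_unitVec η).mapL T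
  simp only [map_smul, h, smul_zero] at h1
  exact h1.unique hasSum_zero

variable [CompleteSpace E]

/-- A bounded operator on `ℓ₂` with summable columns is the norm convergent sum of them. -/
theorem hasSum_columns (T : L2 →L[ℂ] E) (hT : Summable fun j => ‖T (unitVec j)‖) :
    Summable (fun j => ‖(lp.evalCLM ℂ (fun _ : ℕ => ℂ) 2 j).smulRight (T (unitVec j))‖) ∧
    (∀ j, ‖(lp.evalCLM ℂ (fun _ : ℕ => ℂ) 2 j).smulRight (T (unitVec j))‖ ≤ ‖T (unitVec j)‖) ∧
    HasSum (fun j => (lp.evalCLM ℂ (fun _ : ℕ => ℂ) 2 j).smulRight (T (unitVec j))) T := by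
  have hle : ∀ j, ‖(lp.evalCLM ℂ (fun _ : ℕ => ℂ) 2 j).smulRight (T (unitVec j))‖
      ≤ ‖T (unitVec j)‖ := by
    intro j
    rw [ContinuousLinearMap.norm_smulRight_apply]
    refine mul_le_of_le_one_left (norm_nonneg _) ?_
    exact LinearMap.mkContinuous_norm_le _ zero_le_one _
  have hs := Summable.of_nonneg_of_le (fun _ => norm_nonneg _) hle hT
  refine ⟨hs, hle, ?_⟩
  have h1 := hs.of_norm.hasSum
  have he : ∑' j, (lp.evalCLM ℂ (fun _ : ℕ => ℂ) 2 j).smulRight (T (unitVec j)) = T := by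
    refine ContinuousLinearMap.ext fun η => ?_
    have h2 := h1.mapL (ContinuousLinearMap.apply ℂ E η)
    have h3 := (hasSum_unitVec η).mapL T
    simp only [map_smul] at h3
    exact h2.unique h3
  rwa [he] at h1

theorem norm_le_tsum_columns (T : L2 →L[ℂ] E) (hT : Summable fun j => ‖T (unitVec j)‖) :
    ‖T‖ ≤ ∑' j, ‖T (unitVec j)‖ := by
  obtain ⟨hs, hle, hsum⟩ := hasSum_columns T hT
  calc ‖T‖ = ‖∑' j, (lp.evalCLM ℂ (fun _ : ℕ => ℂ) 2 j).smulRight (T (unitVec j))‖ := by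
        rw [hsum.tsum_eq]
    _ ≤ _ := (norm_tsum_le_tsum_norm hs).trans (hs.tsum_le_tsum hle hT)

/-- The column expansion is a norm limit of finite-rank operators. -/
theorem isCompactOperator_of_summable_columns (T : L2 →L[ℂ] E)
    (hT : Summable fun j => ‖T (unitVec j)‖) : IsCompactOperator T := by
  obtain ⟨-, -, hsum⟩ := hasSum_columns T hT
  refine isCompactOperator_of_tendsto hsum (Eventually.of_forall fun s => ?_)
  refine (compactOperator (RingHom.id ℂ) L2 E).sum_mem (t := s) fun j _ => ?_
  have h : IsCompactOperator (lp.evalCLM ℂ (fun _ : ℕ => ℂ) 2 j) :=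
    (isCompactOperator_id (E := ℂ)).comp_clm (lp.evalCLM ℂ (fun _ : ℕ => ℂ) 2 j)
  exact h.clm_comp ((ContinuousLinearMap.id ℂ ℂ).smulRight (T (unitVec j)))

end Columns

/-! ### Compact self-adjoint operators and projections -/

section Hilbert

variable {H : Type*} [NormedAddCommGroup H] [InnerProductSpace ℂ H] [CompleteSpace H]

/-- The spectral radius equals the norm, so the spectrum contains some `μ` with `|μ| = 1`.
Compactness makes it an eigenvalue and self-adjointness makes it real, so `μ² = 1`. -/
theorem exists_apply_apply_eq_self {T : H →L[ℂ] H} (hc : IsCompactOperator T)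
    (hs : IsSelfAdjoint T) (h1 : ‖T‖ = 1) : ∃ y ≠ 0, T (T y) = y := by
  have : Nontrivial H := by
    by_contra hn
    rw [not_nontrivial_iff_subsingleton] at hn
    simp [Subsingleton.elim T 0] at h1
  obtain ⟨μ, hμ, hn⟩ := spectrum.exists_nnnorm_eq_spectralRadius T
  rw [T.spectralRadius_eq_nnnorm hs, ENNReal.coe_inj] at hn
  have hn1 : ‖μ‖ = 1 := by rw [← h1]; exact congrArg NNReal.toReal hn
  have hμ0 : μ ≠ 0 := by rintro rfl; simp at hn1
  have he := (hc.hasEigenvalue_iff_mem_spectrum hμ0).mpr hμ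
  obtain ⟨y, hy⟩ := he.exists_hasEigenvector
  have hy1 : T y = μ • y := hy.apply_eq_smul
  refine ⟨y, hy.2, ?_⟩
  have hconj : (starRingEnd ℂ) μ = μ := hs.isSymmetric.conj_eigenvalue_eq_self he
  have hμμ : μ * μ = 1 := by
    have := Complex.mul_conj μ
    rw [hconj, Complex.normSq_eq_norm_sq, hn1] at this
    simpa using this
  rw [hy1, map_smul, hy1, smul_smul, hμμ, one_smul]

/-- The even powers of a compact self-adjoint operator of norm one converge to a nonzero
projection. -/
theorem exists_isStarProjection_tendsto_pow {T : H →L[ℂ] H} (hc : IsCompactOperator T)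
    (hs : IsSelfAdjoint T) (h1 : ‖T‖ = 1) :
    ∃ p : H →L[ℂ] H, IsStarProjection p ∧ p ≠ 0 ∧ T * T * p = p ∧ p * (T * T) = p ∧
      Tendsto (fun n : ℕ => (T * T) ^ n) atTop (𝓝 p) := by
  -- Squaring merges the eigenvalues `1` and `-1`, whose powers would otherwise oscillate.
  set E : Submodule ℂ H := (T * T - 1).ker with hE
  have hmem : ∀ y, y ∈ E ↔ T (T y) = y := fun y => by
    simp [hE, LinearMap.mem_ker, sub_eq_zero]
  have hEc : IsClosed (E : Set H) := ContinuousLinearMap.isClosed_ker _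
  have : CompleteSpace E := hEc.completeSpace_coe
  set p := E.starProjection with hp
  have hpsp : IsStarProjection p := isStarProjection_starProjection
  have hpm : ∀ y, p y ∈ E := fun y => Submodule.starProjection_apply_mem _ _
  have hps : ∀ y ∈ E, p y = y := fun y hy => Submodule.starProjection_eq_self_iff.mpr hy
  have hTp : p * T * p = T * p := by
    ext y
    refine hps _ ((hmem _).mpr ?_)
    change T (T (T (p y))) = T (p y)
    rw [(hmem _).mp (hpm y)]
  have hcomm : p * T = T * p := by
    have h := congrArg star hTp
    simp only [star_mul, hpsp.isSelfAdjoint.star_eq, hs.star_eq] at h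
    rw [← h, ← mul_assoc, hTp]
  have hTTp : T * T * p = p := by
    ext y; exact (hmem _).mp (hpm y)
  have hpp : p * p = p := hpsp.isIdempotentElem
  have hpTT : p * (T * T) = p := by
    rw [← mul_assoc, hcomm, mul_assoc, hcomm, ← mul_assoc, hTTp]
  refine ⟨p, hpsp, ?_, hTTp, hpTT, ?_⟩
  · obtain ⟨y, hy0, hy⟩ := exists_apply_apply_eq_self hc hs h1
    intro h0
    have := hps y ((hmem y).mpr hy)
    rw [h0] at this
    exact hy0 this.symm
  -- `S` is the part of `T` off `E`. It has norm below one, since a nonzero fixed vector of `S²`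
  -- would lie in `E` and also be killed by `p`. So its powers vanish in the limit.
  set S := T * (1 - p) with hS
  have hSS : S * S = T * T - p := by
    have h2 : (1 - p) * T = T * (1 - p) := by rw [sub_mul, mul_sub, hcomm, one_mul, mul_one]
    have h3 : (1 - p) * (1 - p) = 1 - p := hpsp.one_sub.isIdempotentElem
    calc S * S = T * ((1 - p) * T) * (1 - p) := by simp only [hS, mul_assoc]
      _ = T * T * ((1 - p) * (1 - p)) := by rw [h2]; simp only [mul_assoc]
      _ = _ := by rw [h3, mul_sub, mul_one, hTTp]
  have hSself : IsSelfAdjoint S := by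
    refine (IsSelfAdjoint.commute_iff hs hpsp.one_sub.isSelfAdjoint).mp ?_
    change T * (1 - p) = (1 - p) * T
    rw [sub_mul, mul_sub, hcomm, one_mul, mul_one]
  have hScomp : IsCompactOperator S := hc.comp_clm (1 - p)
  have hSle : ‖S‖ ≤ 1 := by
    calc ‖S‖ ≤ ‖T‖ * ‖1 - p‖ := norm_mul_le _ _
      _ ≤ 1 * 1 := by
        rw [h1]
        gcongr
        exact hpsp.one_sub.norm_le
      _ = 1 := one_mul 1
  have hSlt : ‖S‖ < 1 := by
    refine lt_of_le_of_ne hSle fun h => ?_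
    obtain ⟨y, hy0, hy⟩ := exists_apply_apply_eq_self hScomp hSself h
    have hy2 : (S * S) y = y := hy
    have hpy : p y = 0 := by
      have : p * (S * S) = 0 := by rw [hSS, mul_sub, hpTT, hpp, sub_self]
      have h4 := congrArg (fun R : H →L[ℂ] H => R y) this
      simpa [hy] using h4
    rw [hSS] at hy2
    have : T (T y) = y := by simpa [hpy] using hy2
    rw [hps y ((hmem y).mpr this)] at hpy
    exact hy0 hpy
  have hpow : ∀ n : ℕ, (T * T) ^ (n + 1) = p + (S * S) ^ (n + 1) := by
    intro n
    induction n with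
    | zero => simp [hSS]
    | succ n ih =>
      have hpS : (S * S) ^ (n + 1) * p = 0 := by
        rw [pow_succ, mul_assoc, hSS, sub_mul, hTTp, hpp, sub_self, mul_zero]
      have h5 : T * T = p + S * S := by rw [hSS]; abel
      have h6 : p * (S * S) = 0 := by rw [hSS, mul_sub, hpTT, hpp, sub_self]
      rw [pow_succ (T * T), ih, h5, add_mul, mul_add, mul_add, hpp, hpS, h6, ← pow_succ]
      abel
  rw [← tendsto_add_atTop_iff_nat 1]
  simp_rw [hpow]
  have hlim : Tendsto (fun n : ℕ => (S * S) ^ (n + 1)) atTop (𝓝 0) := by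
    refine (tendsto_add_atTop_iff_nat 1).mpr (tendsto_pow_atTop_nhds_zero_of_norm_lt_one ?_)
    calc ‖S * S‖ ≤ ‖S‖ * ‖S‖ := norm_mul_le _ _
      _ < 1 := by nlinarith [norm_nonneg S]
  simpa using hlim.const_add p

/-- A compact projection restricts to the identity of its closed range; a space with compact
identity is finite-dimensional. -/
theorem IsStarProjection.finiteDimensional_range {p : H →L[ℂ] H} (hp : IsStarProjection p)
    (hc : IsCompactOperator p) : FiniteDimensional ℂ p.range := by
  have hid : ∀ v ∈ p.range, p v = v := by
    rintro _ ⟨v, rfl⟩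
    exact congrArg (fun R : H →L[ℂ] H => R v) hp.isIdempotentElem
  have hcl : IsClosed (p.range : Set H) := by
    have : (p.range : Set H) = ((1 - p).ker : Set H) := by
      ext v
      simp only [SetLike.mem_coe, LinearMap.mem_ker]
      refine ⟨fun h => by simp [hid v h], fun h => ⟨v, ?_⟩⟩
      exact (sub_eq_zero.mp (by simpa using h)).symm
    rw [this]
    exact ContinuousLinearMap.isClosed_ker _
  have h := hc.restrict (f := (p : H →ₗ[ℂ] H)) (V := p.range) (fun v _ => ⟨v, rfl⟩) hcl
  refine FiniteDimensional.of_isCompactOperator_id (𝕜 := ℂ) ?_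
  have he : ((p : H →ₗ[ℂ] H).restrict (p := p.range) (q := p.range) fun v _ => ⟨v, rfl⟩ :
      p.range → p.range) = id :=
    funext fun v => Subtype.ext (hid v v.2)
  rwa [he] at h

end Hilbert

/-! ### The weighted norms of `s` and the steps of `s'` -/

theorem S.toL2_injective (q : ℕ) : Function.Injective (S.toL2 q) := by
  intro a b h
  refine Subtype.ext (funext fun j => ?_)
  have h1 : weight q j * a.1 j = weight q j * b.1 j := congrArg (fun f : L2 => f j) h
  exact mul_left_cancel₀ (weight_ne_zero q j) h1

/-- Cauchy–Schwarz after moving both weights `j^q` to one factor. -/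
theorem S.norm_toL2_sq_le (q : ℕ) (ζ : S) :
    ‖S.toL2 q ζ‖ ^ 2 ≤ ‖S.toL2 (2 * q) ζ‖ * ‖S.toL2 0 ζ‖ := by
  have h : inner ℂ (S.toL2 q ζ) (S.toL2 q ζ) = inner ℂ (S.toL2 (2 * q) ζ) (S.toL2 0 ζ) := by
    rw [lp.inner_eq_tsum, lp.inner_eq_tsum]
    refine tsum_congr fun j => ?_
    change inner ℂ (weight q j * ζ.1 j) (weight q j * ζ.1 j)
      = inner ℂ (weight (2 * q) j * ζ.1 j) (weight 0 j * ζ.1 j)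
    simp only [RCLike.inner_apply, weight, map_mul, map_pow, map_natCast, pow_zero, one_mul]
    ring
  calc ‖S.toL2 q ζ‖ ^ 2 = ‖inner ℂ (S.toL2 q ζ) (S.toL2 q ζ)‖ := by
        rw [inner_self_eq_norm_sq_to_K]; simp
    _ ≤ _ := by rw [h]; exact norm_inner_le_norm _ _

theorem SDual.ofL2_unitVec (q j : ℕ) :
    SDual.ofL2 q (unitVec j) = weight q j • SDual.ofL2 0 (unitVec j) := by
  refine Subtype.ext (funext fun i => ?_)
  change weight q i * unitVec j i = weight q j * (weight 0 i * unitVec j i)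
  by_cases h : i = j
  · subst h; simp [weight]
  · simp [unitVec, Pi.single_eq_of_ne h]

theorem inclusion_eq (ζ : S) : inclusion ζ = SDual.ofL2L 0 (S.toL2L 0 ζ) := by
  refine Subtype.ext (funext fun j => ?_)
  change ζ.1 j = weight 0 j * (weight 0 j * ζ.1 j)
  simp [weight]

theorem norm_weight (q j : ℕ) : ‖weight q j‖ = ((j + 1 : ℕ) : ℝ) ^ q := by
  simp only [weight, norm_pow, Complex.norm_natCast]

instance : T2Space S := by
  have h : WithSeminorms S.seminorms := S.withSeminorms
  have := h.T1_of_separating fun x hx => ⟨0, fun h0 => hx ?_⟩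
  · infer_instance
  · refine S.toL2_injective 0 ?_
    rw [map_zero]
    exact norm_eq_zero.mp h0

/-! ### Smooth operators as operators on `ℓ₂` -/

namespace SmoothOp

theorem withSeminorms : WithSeminorms seminorms := ⟨rfl⟩

/-- The operator `η ↦ (j^p (x (k^q η_k)_k)_j)_j` on `ℓ₂`. -/
noncomputable def weighted (p q : ℕ) (x : SmoothOp) : L2 →L[ℂ] L2 :=
  (S.toL2L p).comp (x.toCLM.comp (SDual.ofL2L q))

theorem weighted_unitVec (p q j : ℕ) (x : SmoothOp) :
    weighted p q x (unitVec j) = weight q j • weighted p 0 x (unitVec j) := by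
  change S.toL2 p (x.toCLM (SDual.ofL2 q (unitVec j))) = weight q j • S.toL2 p (x.toCLM _)
  rw [SDual.ofL2_unitVec, map_smul, map_smul]
  rfl

theorem toL2_mul (x y : SmoothOp) : (x * y).toL2 = x.toL2 * y.toL2 := by
  ext1 η
  change S.toL2L 0 (x.toCLM (inclusion (y.toCLM (SDual.ofL2L 0 η)))) =
    S.toL2L 0 (x.toCLM (SDual.ofL2L 0 (S.toL2L 0 (y.toCLM (SDual.ofL2L 0 η)))))
  rw [inclusion_eq]

theorem toL2_add (x y : SmoothOp) : (x + y).toL2 = x.toL2 + y.toL2 := map_add (sandwich 0) x y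
theorem toL2_sub (x y : SmoothOp) : (x - y).toL2 = x.toL2 - y.toL2 := map_sub (sandwich 0) x y
theorem toL2_smul (c : ℂ) (x : SmoothOp) : (c • x).toL2 = c • x.toL2 := map_smul (sandwich 0) c x
theorem toL2_zero : (0 : SmoothOp).toL2 = 0 := map_zero (sandwich 0)

/-- Every `ξ` in `s'` lies in some step, where it is a convergent series in the unit vectors; the
embeddings of a unit vector through different steps differ only by a scalar. -/
theorem eq_zero_of_toL2_eq_zero {x : SmoothOp} (h : x.toL2 = 0) : x = 0 := by
  ext ⟨ξ, q, hq⟩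
  have h1 : x.toCLM.comp (SDual.ofL2L q) = 0 := by
    refine clm_eq_zero_of_unitVec _ fun j => ?_
    have h2 : x.toCLM (SDual.ofL2 0 (unitVec j)) = 0 := by
      refine S.toL2_injective 0 ?_
      rw [map_zero]
      exact congrArg (fun T : L2 →L[ℂ] L2 => T (unitVec j)) h
    change x.toCLM (SDual.ofL2 q (unitVec j)) = 0
    rw [SDual.ofL2_unitVec, map_smul, h2, smul_zero]
  have h3 : SDual.ofL2 q ⟨_, hq⟩ = ⟨ξ, q, hq⟩ := by
    refine Subtype.ext (funext fun j => ?_)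
    exact mul_inv_cancel_left₀ (weight_ne_zero q j) _
  rw [← h3]
  exact congrArg (fun T : L2 →L[ℂ] S => T ⟨_, hq⟩) h1

theorem toL2_injective : Function.Injective toL2 := by
  intro x y h
  rw [← sub_eq_zero]
  exact eq_zero_of_toL2_eq_zero (by rw [toL2_sub, h, sub_self])

/-- For smooth `a`, `b` and bounded `T`, the smooth operator `a T b`. -/
noncomputable def compress (a b : SmoothOp) : (L2 →L[ℂ] L2) →ₗ[ℂ] SmoothOp where
  toFun T := (a.toCLM.comp (SDual.ofL2L 0)).comp (T.comp ((S.toL2L 0).comp b.toCLM))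
  map_add' T R := by
    rw [ContinuousLinearMap.add_comp, ContinuousLinearMap.comp_add]; rfl
  map_smul' c T := by
    rw [ContinuousLinearMap.smul_comp, ContinuousLinearMap.comp_smul]; rfl

theorem toL2_compress (a b : SmoothOp) (T : L2 →L[ℂ] L2) :
    (compress a b T).toL2 = a.toL2 * T * b.toL2 := rfl

theorem sandwich_compress (q : ℕ) (a b : SmoothOp) (T : L2 →L[ℂ] L2) :
    sandwich q (compress a b T) = weighted q 0 a * T * weighted 0 q b := rfl

/-- Smooth factors on both sides turn operator norm convergence on `ℓ₂` into convergence in `L(s',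
s)`. -/
theorem continuous_compress (a b : SmoothOp) : Continuous (compress a b) := by
  refine withSeminorms.continuous_normedSpace_dom _ _ fun q =>
    ⟨‖weighted q 0 a‖₊ * ‖weighted 0 q b‖₊, fun T => ?_⟩
  change ‖sandwich q (compress a b T)‖ ≤ (‖weighted q 0 a‖ * ‖weighted 0 q b‖) * ‖T‖
  rw [sandwich_compress]
  calc _ ≤ ‖weighted q 0 a‖ * ‖T‖ * ‖weighted 0 q b‖ := norm_mul₃_le
    _ = _ := by ring

theorem continuous_toL2 : Continuous (sandwich 0) :=
  withSeminorms.continuous_normedSpace_rng _ _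
    ⟨{0}, 1, by rw [Finset.sup_singleton, one_smul]; exact le_rfl⟩

/-- The vector `j^q e_j` is a unit vector of the `q`-th step, on which `x` is bounded. -/
theorem norm_toL2_unitVec_le (q j : ℕ) (x : SmoothOp) :
    ‖x.toL2 (unitVec j)‖ ≤ ‖weighted 0 q x‖ / ((j + 1 : ℕ) : ℝ) ^ q := by
  have hpos : 0 < ((j + 1 : ℕ) : ℝ) ^ q := by positivity
  rw [le_div_iff₀ hpos, mul_comm, ← norm_weight]
  calc ‖weight q j‖ * ‖x.toL2 (unitVec j)‖ = ‖weighted 0 q x (unitVec j)‖ := by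
        rw [weighted_unitVec, norm_smul]; rfl
    _ ≤ _ := by
        simpa [norm_unitVec] using (weighted 0 q x).le_opNorm (unitVec j)

theorem norm_sandwich_unitVec_le (q j : ℕ) (y : SmoothOp) :
    ‖sandwich q y (unitVec j)‖ ≤
      ((j + 1 : ℕ) : ℝ) ^ q * √(‖weighted (2 * q) 0 y‖ * ‖y.toL2 (unitVec j)‖) := by
  have h : sandwich q y (unitVec j) = _ := weighted_unitVec q q j y
  rw [h, norm_smul, norm_weight]
  refine mul_le_mul_of_nonneg_left (Real.le_sqrt_of_sq_le ?_) (by positivity)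
  refine (S.norm_toL2_sq_le q (y.toCLM (SDual.ofL2 0 (unitVec j)))).trans ?_
  refine mul_le_mul_of_nonneg_right ?_ (norm_nonneg _)
  have h2 := (weighted (2 * q) 0 y).le_opNorm (unitVec j)
  rwa [norm_unitVec, mul_one] at h2

theorem summable_inv_sq : Summable fun j : ℕ => (((j + 1 : ℕ) : ℝ) ^ 2)⁻¹ :=
  (summable_nat_add_iff 1).mpr (Real.summable_nat_pow_inv.mpr one_lt_two)

theorem summable_norm_toL2_unitVec (x : SmoothOp) : Summable fun j => ‖x.toL2 (unitVec j)‖ :=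
  Summable.of_nonneg_of_le (fun _ => norm_nonneg _) (norm_toL2_unitVec_le 2 · x)
    (summable_inv_sq.mul_left _)

theorem isCompactOperator_toL2 (x : SmoothOp) : IsCompactOperator x.toL2 :=
  isCompactOperator_of_summable_columns _ (summable_norm_toL2_unitVec x)

end SmoothOp

/-! ### Projections in a commutative subalgebra -/

variable {A : NonUnitalSubalgebra ℂ SmoothOp}

/-- The canonical embedding of a subalgebra of `L(s', s)` into `L(ℓ₂)`. -/
noncomputable def op : A →ₙₐ[ℂ] (L2 →L[ℂ] L2) where
  toFun x := (x : SmoothOp).toL2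
  map_smul' c x := SmoothOp.toL2_smul c x
  map_zero' := SmoothOp.toL2_zero
  map_add' x y := SmoothOp.toL2_add x y
  map_mul' x y := SmoothOp.toL2_mul x y

theorem op_injective : Function.Injective (op (A := A)) :=
  fun _ _ h => Subtype.ext (SmoothOp.toL2_injective h)

theorem op_mul_apply (x y : A) (v : L2) : op (x * y) v = op x (op y v) := by
  rw [map_mul]; rfl

theorem exists_unit_vector {P : A} (hP : P ∈ projections A) :
    ∃ v : L2, ‖v‖ = 1 ∧ (P : SmoothOp).toL2 v = v := by
  have h0 : (P : SmoothOp).toL2 ≠ 0 := fun h =>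
    hP.1 (Subtype.ext (SmoothOp.eq_zero_of_toL2_eq_zero h))
  obtain ⟨w, hw⟩ : ∃ w, (P : SmoothOp).toL2 w ≠ 0 := by
    by_contra! h
    exact h0 (ContinuousLinearMap.ext h)
  refine ⟨((‖(P : SmoothOp).toL2 w‖⁻¹ : ℝ) : ℂ) • (P : SmoothOp).toL2 w, ?_, ?_⟩
  · rw [norm_smul, Complex.norm_real, norm_inv, norm_norm,
      inv_mul_cancel₀ (norm_ne_zero_iff.mpr hw)]
  · rw [map_smul]
    congr 1
    exact congrArg (fun T : L2 →L[ℂ] L2 => T w) hP.2.isIdempotentElem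

theorem mul_self_of_mem_projections {P : A} (hP : P ∈ projections A) : P * P = P := by
  refine op_injective ?_
  rw [map_mul]
  exact hP.2.isIdempotentElem

theorem mul_mem_projections (hA : ∀ x y : A, x * y = y * x) {P Q : A} (hP : P ∈ projections A)
    (hQ : Q ∈ projections A) (h : P * Q ≠ 0) : P * Q ∈ projections A := by
  refine ⟨h, ?_⟩
  change IsStarProjection (op (P * Q))
  rw [map_mul]
  refine IsStarProjection.mul hP.2 hQ.2 ?_
  change op P * op Q = op Q * op P
  rw [← map_mul, hA, map_mul]

theorem eq_of_mul_eq (hA : ∀ x y : A, x * y = y * x) {P Q : A} (hP : P ∈ minimalProjections A)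
    (hQ : Q ∈ projections A) (h : Q * P = Q) : Q = P :=
  hP.2 Q hQ ⟨h, by rw [hA, h]⟩

/-- If nonzero, `P * Q` would be a projection below both, hence equal to both. -/
theorem mul_eq_zero_of_minimal (hA : ∀ x y : A, x * y = y * x) {P Q : A}
    (hP : P ∈ minimalProjections A) (hQ : Q ∈ minimalProjections A) (hne : P ≠ Q) :
    P * Q = 0 := by
  by_contra h
  have hm := mul_mem_projections hA hP.1 hQ.1 h
  have h1 : P * Q = P := eq_of_mul_eq hA hP hm (by
    rw [hA P Q, mul_assoc, mul_self_of_mem_projections hP.1])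
  have h2 : P * Q = Q := eq_of_mul_eq hA hQ hm (by
    rw [mul_assoc, mul_self_of_mem_projections hQ.1])
  exact hne (h1.symm.trans h2)

theorem inner_eq_zero_of_mul_eq_zero {P Q : A} (hP : P ∈ projections A) (h : P * Q = 0)
    {v w : L2} (hv : op P v = v) (hw : op Q w = w) : inner ℂ v w = 0 := by
  calc inner ℂ v w = inner ℂ (op P v) w := by rw [hv]
    _ = inner ℂ v (op P w) := hP.2.isSelfAdjoint.isSymmetric v w
    _ = inner ℂ v (op (P * Q) w) := by rw [op_mul_apply, hw]
    _ = 0 := by rw [h, map_zero, zero_apply, inner_zero_right]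

/-- Unit vectors in the ranges of the minimal projections. -/
noncomputable def minimalVec (P : minimalProjections A) : L2 :=
  (exists_unit_vector P.2.1).choose

theorem norm_minimalVec (P : minimalProjections A) : ‖minimalVec P‖ = 1 :=
  (exists_unit_vector P.2.1).choose_spec.1

theorem apply_minimalVec (P : minimalProjections A) :
    (P.1 : SmoothOp).toL2 (minimalVec P) = minimalVec P :=
  (exists_unit_vector P.2.1).choose_spec.2

theorem orthonormal_minimalVec (hA : ∀ x y : A, x * y = y * x) :
    Orthonormal ℂ (minimalVec (A := A)) :=
  ⟨norm_minimalVec, fun P Q h => inner_eq_zero_of_mul_eq_zero P.2.1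
    (mul_eq_zero_of_minimal hA P.2 Q.2 fun h1 => h (Subtype.ext h1))
    (apply_minimalVec P) (apply_minimalVec Q)⟩

/-- By Bessel, each `e_j` is non-orthogonal to only countably many of the orthonormal vectors
`minimalVec P`, and each of these is non-orthogonal to some `e_j`. -/
theorem countable_minimalProjections (hA : ∀ x y : A, x * y = y * x) :
    (minimalProjections A).Countable := by
  have hv := orthonormal_minimalVec hA
  have hc : (⋃ j : ℕ, {P : minimalProjections A |
      inner ℂ (minimalVec P) (unitVec j) ≠ 0}).Countable := by
    refine Set.countable_iUnion fun j => ?_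
    refine (hv.inner_products_summable (x := unitVec j)).countable_support.mono fun P hP => ?_
    simpa using hP
  rw [← Set.countable_coe_iff, ← Set.countable_univ_iff]
  refine hc.mono fun P _ => ?_
  rw [Set.mem_iUnion]
  by_contra! h
  have h1 : innerSL ℂ (minimalVec P) = 0 := clm_eq_zero_of_unitVec _ fun j => by
    simpa using h j
  have h2 : inner ℂ (minimalVec P) (minimalVec P) = 0 :=
    congrArg (fun T : L2 →L[ℂ] ℂ => T (minimalVec P)) h1
  have h3 := norm_minimalVec P
  rw [inner_self_eq_zero.mp h2, norm_zero] at h3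
  exact zero_ne_one h3

theorem projection_mul_sum_minimal (hA : ∀ x y : A, x * y = y * x) {F : Finset A}
    (hF : (F : Set A) ⊆ minimalProjections A) {R : A} (hR : R ∈ F) : R * ∑ Q ∈ F, Q = R := by
  classical
  rw [Finset.mul_sum, Finset.sum_eq_single_of_mem R hR]
  · exact mul_self_of_mem_projections (hF hR).1
  · exact fun Q hQ hne => mul_eq_zero_of_minimal hA (hF hR) (hF hQ) hne.symm

/-- Induction on the rank: a non-minimal `P` splits as `Q + (P - Q)` into projections of smaller
rank. -/
theorem exists_sum_minimal (hA : ∀ x y : A, x * y = y * x) {P : A} (hP : P ∈ projections A) :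
    ∃ F : Finset A, (F : Set A) ⊆ minimalProjections A ∧ P = ∑ Q ∈ F, Q := by
  classical
  obtain ⟨n, hn⟩ : ∃ n, n = Module.finrank ℂ (P : SmoothOp).toL2.range := ⟨_, rfl⟩
  induction n using Nat.strong_induction_on generalizing P with
  | _ n ih =>
  by_cases hmin : P ∈ minimalProjections A
  · exact ⟨{P}, by simpa using hmin, by simp⟩
  have hlt : ∀ Q ∈ projections A, Q * P = Q → Q ≠ P →
      Module.finrank ℂ (Q : SmoothOp).toL2.range < n := by
    intro Q hQ hQP hne
    have := IsStarProjection.finiteDimensional_range hP.2 (SmoothOp.isCompactOperator_toL2 P)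
    rw [hn]
    refine Submodule.finrank_lt_finrank_of_lt (lt_of_le_of_ne ?_ fun h => hne ?_)
    · rintro _ ⟨v, rfl⟩
      refine ⟨(Q : SmoothOp).toL2 v, ?_⟩
      change op P (op Q v) = op Q v
      rw [← op_mul_apply, hA, hQP]
    · rw [← hQP]
      refine op_injective (ContinuousLinearMap.ext fun v => ?_)
      have hv : op P v ∈ (op Q).range := h ▸ ⟨v, rfl⟩
      obtain ⟨w, hw⟩ := hv
      change op Q w = op P v at hw
      rw [op_mul_apply, ← hw, ← op_mul_apply, mul_self_of_mem_projections hQ]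
  have : ∃ Q ∈ projections A, Q * P = Q ∧ Q ≠ P := by
    by_contra! h
    exact hmin ⟨hP, fun Q hQ hle => h Q hQ hle.1⟩
  obtain ⟨Q, hQ, hQP, hne⟩ := this
  have hPP := mul_self_of_mem_projections hP
  have hD : P - Q ∈ projections A := by
    refine ⟨sub_ne_zero.mpr hne.symm, ?_⟩
    change IsStarProjection (op (P - Q))
    rw [map_sub]
    refine IsStarProjection.sub_of_mul_eq_left hQ.2 hP.2 ?_
    change op Q * op P = op Q
    rw [← map_mul, hQP]
  obtain ⟨F, hF, hQF⟩ := ih _ (hlt Q hQ hQP hne) hQ rfl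
  obtain ⟨G, hG, hDG⟩ := ih _ (hlt (P - Q) hD (by rw [sub_mul, hPP, hQP])
    (fun h => hQ.1 (by simpa using h))) hD rfl
  refine ⟨F ∪ G, by simpa using ⟨hF, hG⟩, ?_⟩
  rw [Finset.sum_union, ← hQF, ← hDG, add_sub_cancel]
  -- A common summand `R` would satisfy `R Q = R` and `R (P - Q) = R`, forcing `R = 0`.
  refine Finset.disjoint_left.mpr fun R hRF hRG => (hF hRF).1.1 ?_
  have h1 := projection_mul_sum_minimal hA hF hRF
  have h2 := projection_mul_sum_minimal hA hG hRG
  rw [← hQF] at h1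
  rw [← hDG, mul_sub, h1, ← h1, mul_assoc, hQP, sub_self] at h2
  rw [← h1, ← h2]

/-! ### Spectral projections in a closed `*`-subalgebra -/

theorem exists_top_projection (hcl : IsClosed (A : Set SmoothOp)) {h : A}
    (hs : IsSelfAdjoint (op h)) (h0 : h ≠ 0) :
    ∃ P ∈ projections A, h * h * P = ((‖op h‖ : ℂ) ^ 2) • P := by
  have hop : op h ≠ 0 := fun h1 => h0 (op_injective (h1.trans (map_zero op).symm))
  have hr : (‖op h‖ : ℂ) ≠ 0 := by exact_mod_cast norm_ne_zero_iff.mpr hop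
  set g : A := (‖op h‖ : ℂ)⁻¹ • h with hg
  have hgs : IsSelfAdjoint (op g) := by
    rw [hg, map_smul]
    refine IsSelfAdjoint.smul ?_ hs
    rw [← Complex.ofReal_inv]
    exact Complex.conj_ofReal _
  have hg1 : ‖op g‖ = 1 := by
    rw [hg, map_smul, norm_smul, norm_inv, Complex.norm_real, norm_norm,
      inv_mul_cancel₀ (norm_ne_zero_iff.mpr hop)]
  obtain ⟨p, hp, hp0, hTp, hpT, hlim⟩ :=
    exists_isStarProjection_tendsto_pow (SmoothOp.isCompactOperator_toL2 g) hgs hg1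
  change op g * op g * p = p at hTp
  change p * (op g * op g) = p at hpT
  change Tendsto (fun n : ℕ => (op g * op g) ^ n) atTop (𝓝 p) at hlim
  -- Exponents start at one because `A` need not be unital.
  have hpow : ∀ n : ℕ, ∃ w : A, op w = (op g * op g) ^ (n + 1) := by
    intro n
    induction n with
    | zero => exact ⟨g * g, by rw [map_mul, zero_add, pow_one]⟩
    | succ n ih =>
      obtain ⟨w, hw⟩ := ih
      exact ⟨w * (g * g), by rw [map_mul, hw, map_mul, pow_succ _ (n + 1)]⟩
  have hmem : SmoothOp.compress (g * g : A) (g * g : A) p ∈ A := by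
    refine hcl.mem_of_tendsto (((SmoothOp.continuous_compress (g * g : A) (g * g : A)).tendsto p).comp
      ((tendsto_add_atTop_iff_nat 1).mpr hlim)) (Eventually.of_forall fun n => ?_)
    obtain ⟨w, hw⟩ := hpow n
    have : SmoothOp.compress (g * g : A) (g * g : A) ((op g * op g) ^ (n + 1))
        = ((g * g * w * (g * g) : A) : SmoothOp) := by
      refine SmoothOp.toL2_injective ?_
      rw [SmoothOp.toL2_compress]
      change op (g * g) * _ * op (g * g) = op (g * g * w * (g * g))
      rw [map_mul op (g * g * w), map_mul op (g * g) w, hw]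
    change SmoothOp.compress (g * g : A) (g * g : A) ((op g * op g) ^ (n + 1)) ∈ A
    rw [this]
    exact Subtype.prop _
  have hPp : op ⟨_, hmem⟩ = p := by
    change (SmoothOp.compress (g * g : A) (g * g : A) p).toL2 = p
    rw [SmoothOp.toL2_compress]
    change op (g * g) * p * op (g * g) = p
    rw [map_mul, hTp, hpT]
  refine ⟨⟨_, hmem⟩, ⟨fun h1 => hp0 ?_, ?_⟩, op_injective ?_⟩
  · rw [← hPp, h1, map_zero]
  · change IsStarProjection (op ⟨_, hmem⟩)
    rwa [hPp]
  · have hh : op h = (‖op h‖ : ℂ) • op g := by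
      rw [hg, map_smul, smul_smul, mul_inv_cancel₀ hr, one_smul]
    rw [map_mul, map_mul, map_smul, hPp]
    nth_rewrite 1 2 [hh]
    rw [smul_mul_smul_comm, smul_mul_assoc, hTp, sq]

/-- A closed `*`-subalgebra contains, for every `z ≠ 0`, the projection onto the
eigenspace of `|z|` for its largest eigenvalue. -/
theorem exists_top_projection_star (hcl : IsClosed (A : Set SmoothOp))
    (hadj : IsStarSubalgebra A) {z : A} (hz : z ≠ 0) :
    ∃ z' : A, ∃ E ∈ projections A, ‖op z'‖ = ‖op z‖ ∧
      (z' * z) * (z' * z) * E = ((‖op z‖ : ℂ) ^ 4) • E := by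
  obtain ⟨y, hy, hyz⟩ := hadj z z.2
  have hn : op (⟨y, hy⟩ * z) = star (op z) * op z := by rw [map_mul]; congr 1
  have hnorm : ‖op (⟨y, hy⟩ * z)‖ = ‖op z‖ * ‖op z‖ := by
    rw [hn]
    exact (op z).norm_adjoint_comp_self
  -- For `h = z* z` the norm is `‖z‖²`, whence the fourth power.
  obtain ⟨E, hE, h⟩ := exists_top_projection hcl (h := ⟨y, hy⟩ * z)
    (by rw [hn]; exact IsSelfAdjoint.star_mul_self _) (fun h0 => hz (op_injective (by
      rw [h0, map_zero, norm_zero] at hnorm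
      rw [map_zero]
      exact norm_eq_zero.mp (mul_self_eq_zero.mp hnorm.symm))))
  refine ⟨⟨y, hy⟩, E, hE, ?_, ?_⟩
  · change ‖y.toL2‖ = _
    rw [hyz]
    exact norm_star (op z)
  · rw [h, hnorm]
    push_cast
    congr 1
    ring

/-- On the finite-dimensional invariant range of `P`, `x` has an eigenvector `v` with eigenvalue
`c`. If `z = xP - cP` were nonzero, its top projection would lie below `P`, hence equal `P`; then
`(z* z)²` would act on `v` as `‖z‖⁴ ≠ 0`, although `z v = 0`. -/
theorem exists_mul_minimal_eq_smul (hA : ∀ x y : A, x * y = y * x)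
    (hcl : IsClosed (A : Set SmoothOp)) (hadj : IsStarSubalgebra A) {P : A}
    (hP : P ∈ minimalProjections A) (x : A) :
    ∃ c : ℂ, x * P = c • P := by
  have hid : ∀ v ∈ (op P).range, op P v = v := by
    rintro _ ⟨v, rfl⟩
    exact congrArg (fun T : L2 →L[ℂ] L2 => T v) hP.1.2.isIdempotentElem
  have := IsStarProjection.finiteDimensional_range hP.1.2 (SmoothOp.isCompactOperator_toL2 P)
  change FiniteDimensional ℂ (op P).range at this
  have hmaps : ∀ v ∈ (op P).range, op x v ∈ (op P).range := by
    intro v hv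
    refine ⟨op x v, ?_⟩
    change op P (op x v) = op x v
    rw [← op_mul_apply, hA, op_mul_apply, hid v hv]
  obtain ⟨u, hu1, hu⟩ := exists_unit_vector hP.1
  have : Nontrivial (op P).range := by
    refine ⟨⟨⟨u, u, hu⟩, 0, fun h => ?_⟩⟩
    rw [show u = 0 from congrArg Subtype.val h, norm_zero] at hu1
    exact zero_ne_one hu1
  obtain ⟨c, hc⟩ := Module.End.exists_eigenvalue ((op x : L2 →ₗ[ℂ] L2).restrict hmaps)
  obtain ⟨⟨v, hv⟩, hvc⟩ := hc.exists_hasEigenvector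
  have hxv : op x v = c • v := congrArg Subtype.val hvc.apply_eq_smul
  have hv0 : v ≠ 0 := fun h => hvc.2 (Subtype.ext h)
  have hPP := mul_self_of_mem_projections hP.1
  refine ⟨c, sub_eq_zero.mp ?_⟩
  by_contra hz
  obtain ⟨z', E, hE, -, h⟩ := exists_top_projection_star hcl hadj hz
  set z := x * P - c • P with hzdef
  have hzP : z * P = z := by rw [hzdef, sub_mul, mul_assoc, hPP, smul_mul_assoc, hPP]
  have hzv : op z v = 0 := by
    rw [hzdef, map_sub, map_smul, sub_apply, smul_apply, op_mul_apply, hid v hv, hxv, sub_self]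
  have hr : (‖op z‖ : ℂ) ^ 4 ≠ 0 := by
    refine pow_ne_zero _ ?_
    have : op z ≠ 0 := fun h1 => hz (op_injective (h1.trans (map_zero op).symm))
    exact_mod_cast norm_ne_zero_iff.mpr this
  have hEP : E * P = E := by
    have h2 : (‖op z‖ : ℂ) ^ 4 • (E * P) = (‖op z‖ : ℂ) ^ 4 • E := by
      rw [← smul_mul_assoc, ← h, mul_assoc, hA E P, ← mul_assoc, mul_assoc (z' * z) (z' * z) P,
        mul_assoc z' z P, hzP]
    exact smul_right_injective A hr h2
  rw [eq_of_mul_eq hA hP hE hEP] at h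
  have h3 := congrArg (fun y => op y v) h
  simp only [op_mul_apply, hid v hv, hzv, map_zero, map_smul, smul_apply] at h3
  exact (smul_ne_zero hr hv0) h3.symm

/-! ### Convergence of the partial sums -/

/-- Partial sums of the minimal projections. -/
noncomputable def partialSum (rank : minimalProjections A ↪ ℕ) (n : ℕ) : A :=
  ∑ i ∈ (Finset.range n).preimage rank rank.injective.injOn, (i : A)

theorem minimal_mul_sum (hA : ∀ x y : A, x * y = y * x) {s : Finset (minimalProjections A)}
    {P : minimalProjections A} (hP : P ∈ s) : (P : A) * ∑ i ∈ s, (i : A) = P := by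
  classical
  rw [Finset.mul_sum, Finset.sum_eq_single_of_mem P hP]
  · exact mul_self_of_mem_projections P.2.1
  · exact fun Q _ hne => mul_eq_zero_of_minimal hA P.2 Q.2 fun h => hne (Subtype.ext h.symm)

theorem sum_mul_sum_minimal (hA : ∀ x y : A, x * y = y * x) {s t : Finset (minimalProjections A)}
    (h : s ⊆ t) : (∑ i ∈ s, (i : A)) * ∑ i ∈ t, (i : A) = ∑ i ∈ s, (i : A) := by
  rw [Finset.sum_mul]
  exact Finset.sum_congr rfl fun P hP => minimal_mul_sum hA (h hP)

theorem minimal_mul_partialSum (hA : ∀ x y : A, x * y = y * x) (rank : minimalProjections A ↪ ℕ)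
    {P : minimalProjections A} {n : ℕ} (h : rank P < n) : (P : A) * partialSum rank n = P :=
  minimal_mul_sum hA (by simpa using h)

theorem partialSum_mul (hA : ∀ x y : A, x * y = y * x) (rank : minimalProjections A ↪ ℕ)
    {m n : ℕ} (h : m ≤ n) : partialSum rank m * partialSum rank n = partialSum rank m :=
  sum_mul_sum_minimal hA fun P hP => by
    simp only [Finset.mem_preimage, Finset.mem_range] at hP ⊢
    exact hP.trans_le h

theorem isStarProjection_partialSum (hA : ∀ x y : A, x * y = y * x)
    (rank : minimalProjections A ↪ ℕ) (n : ℕ) : IsStarProjection (op (partialSum rank n)) where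
  isIdempotentElem := by
    change op _ * op _ = op _
    rw [← map_mul, partialSum_mul hA rank le_rfl]
  isSelfAdjoint := by
    rw [partialSum, map_sum]
    exact isSelfAdjoint_sum _ fun P _ => P.2.1.2.isSelfAdjoint

/-- Projections onto an increasing sequence of subspaces converge strongly. -/
theorem cauchySeq_partialSum_apply (hA : ∀ x y : A, x * y = y * x)
    (rank : minimalProjections A ↪ ℕ) (v : L2) :
    CauchySeq fun n => op (partialSum rank n) v := by
  choose hU hS using fun n =>
    isStarProjection_iff_eq_starProjection_range.mp
      (isStarProjection_partialSum hA rank n)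
  have hmono : Monotone fun n => (op (partialSum rank n)).range := by
    rintro m n hmn _ ⟨w, rfl⟩
    refine ⟨op (partialSum rank m) w, ?_⟩
    change op (partialSum rank n) (op (partialSum rank m) w) = op (partialSum rank m) w
    rw [← op_mul_apply, hA, partialSum_mul hA rank hmn]
  have h := Submodule.starProjection_tendsto_closure_iSup
    (fun n => (op (partialSum rank n)).range) hmono v
  refine (h.congr fun n => ?_).cauchySeq
  rw [← hS n]

theorem norm_op_partialSum_apply_le (hA : ∀ x y : A, x * y = y * x)
    (rank : minimalProjections A ↪ ℕ) (n : ℕ) (v : L2) : ‖op (partialSum rank n) v‖ ≤ ‖v‖ := by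
  simpa using (op (partialSum rank n)).le_of_opNorm_le
    (isStarProjection_partialSum hA rank n).norm_le v

/-- By commutativity the columns are `S_n (x e_j)`. Each is Cauchy in `n`, and the differences are
dominated by the summable `2 ‖x e_j‖`. -/
theorem cauchySeq_op_mul_partialSum (hA : ∀ x y : A, x * y = y * x)
    (rank : minimalProjections A ↪ ℕ) (x : A) :
    CauchySeq fun n => op (x * partialSum rank n) := by
  rw [cauchySeq_iff_tendsto_dist_atTop_0]
  have hcol : ∀ (n : ℕ × ℕ) (j : ℕ),
      (op (x * partialSum rank n.1) - op (x * partialSum rank n.2)) (unitVec j) =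
        op (partialSum rank n.1) (op x (unitVec j)) -
          op (partialSum rank n.2) (op x (unitVec j)) := by
    intro n j
    rw [sub_apply, hA x, hA x, op_mul_apply, op_mul_apply]
  have hbd : ∀ (n : ℕ × ℕ) (j : ℕ),
      ‖(op (x * partialSum rank n.1) - op (x * partialSum rank n.2)) (unitVec j)‖ ≤
        2 * ‖op x (unitVec j)‖ := by
    intro n j
    rw [hcol, two_mul]
    exact (norm_sub_le _ _).trans (add_le_add (norm_op_partialSum_apply_le hA rank _ _)
      (norm_op_partialSum_apply_le hA rank _ _))
  have hs : Summable fun j => 2 * ‖op x (unitVec j)‖ :=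
    (SmoothOp.summable_norm_toL2_unitVec x).mul_left 2
  have hlim := tendsto_tsum_of_dominated_convergence (𝓕 := atTop)
    (f := fun (n : ℕ × ℕ) j =>
      ‖(op (x * partialSum rank n.1) - op (x * partialSum rank n.2)) (unitVec j)‖)
    (g := fun _ => (0 : ℝ)) hs (fun j => by
      simp only [hcol]
      have h := cauchySeq_iff_tendsto_dist_atTop_0.mp
        (cauchySeq_partialSum_apply hA rank (op x (unitVec j)))
      simpa only [dist_eq_norm] using h)
    (Eventually.of_forall fun n j => by rw [norm_norm]; exact hbd n j)
  rw [tsum_zero] at hlim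
  refine squeeze_zero (fun _ => dist_nonneg) (fun n => ?_) hlim
  rw [dist_eq_norm]
  exact norm_le_tsum_columns _ (Summable.of_nonneg_of_le (fun _ => norm_nonneg _) (hbd n) hs)

/-- The norm of `z = x - x S_n` is attained on the range of its top projection `E`. As `E` is a
finite sum of minimal projections, `S_m` fixes that range for large `m`, so `z` agrees there with `x
S_m - x S_n`. -/
theorem eventually_norm_sub_le (hA : ∀ x y : A, x * y = y * x)
    (hcl : IsClosed (A : Set SmoothOp)) (hadj : IsStarSubalgebra A)
    (rank : minimalProjections A ↪ ℕ) (x : A) (n : ℕ) :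
    ∀ᶠ m in atTop, ‖op (x - x * partialSum rank n)‖ ≤
      ‖op (x * partialSum rank m) - op (x * partialSum rank n)‖ := by
  set z := x - x * partialSum rank n with hz
  by_cases hz0 : z = 0
  · simp [hz0]
  obtain ⟨z', E, hE, hn, h⟩ := exists_top_projection_star hcl hadj hz0
  obtain ⟨F, hF, hEF⟩ := exists_sum_minimal hA hE
  have hev : ∀ᶠ m in atTop, ∀ Q ∈ F, Q * partialSum rank m = Q := by
    rw [eventually_all_finset]
    intro Q hQ
    filter_upwards [eventually_gt_atTop (rank ⟨Q, hF hQ⟩)] with m hm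
    exact minimal_mul_partialSum hA rank (P := ⟨Q, hF hQ⟩) hm
  filter_upwards [hev] with m hm
  have hES : partialSum rank m * E = E := by
    rw [hA, hEF, Finset.sum_mul]
    exact Finset.sum_congr rfl hm
  obtain ⟨u, hu1, hu⟩ := exists_unit_vector hE
  change op E u = u at hu
  set δ := ‖op (x * partialSum rank m) - op (x * partialSum rank n)‖
  have hzu : ‖op z u‖ ≤ δ := by
    have h1 : op z u = (op (x * partialSum rank m) - op (x * partialSum rank n)) u := by
      have h2 : op (x * partialSum rank m) u = op x u := by
        rw [← hu, ← op_mul_apply, ← op_mul_apply, mul_assoc, hES]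
      rw [hz, map_sub, sub_apply, sub_apply, h2]
    rw [h1]
    have h2 := (op (x * partialSum rank m) - op (x * partialSum rank n)).le_opNorm u
    rwa [hu1, mul_one] at h2
  have hpos : 0 < ‖op z‖ := by
    refine norm_pos_iff.mpr fun h1 => hz0 (op_injective (h1.trans (map_zero op).symm))
  have h3 : op z' (op z (op z' (op z u))) = (‖op z‖ : ℂ) ^ 4 • u := by
    have h4 := congrArg (fun y => op y u) h
    simpa only [op_mul_apply, hu, map_smul, smul_apply] using h4
  have h5 : ‖op z‖ ^ 4 ≤ ‖op z‖ * (‖op z‖ * (‖op z‖ * δ)) := by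
    calc ‖op z‖ ^ 4 = ‖op z' (op z (op z' (op z u)))‖ := by
          rw [h3, norm_smul, hu1, norm_pow, Complex.norm_real, norm_norm, mul_one]
      _ ≤ ‖op z'‖ * (‖op z‖ * (‖op z'‖ * ‖op z u‖)) :=
          (op z').le_opNorm_of_le ((op z).le_opNorm_of_le ((op z').le_opNorm _))
      _ ≤ _ := by rw [hn]; gcongr
  have h6 : ‖op z‖ ^ 3 * ‖op z‖ ≤ ‖op z‖ ^ 3 * δ := by nlinarith [h5]
  exact le_of_mul_le_mul_left h6 (by positivity)

theorem tendsto_norm_op_sub (hA : ∀ x y : A, x * y = y * x)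
    (hcl : IsClosed (A : Set SmoothOp)) (hadj : IsStarSubalgebra A)
    (rank : minimalProjections A ↪ ℕ) (x : A) :
    Tendsto (fun n => ‖op (x - x * partialSum rank n)‖) atTop (𝓝 0) := by
  rw [Metric.tendsto_atTop]
  intro ε hε
  obtain ⟨N, hN⟩ := Metric.cauchySeq_iff.mp (cauchySeq_op_mul_partialSum hA rank x) ε hε
  refine ⟨N, fun n hn => ?_⟩
  obtain ⟨m, hm, hmN⟩ :=
    ((eventually_norm_sub_le hA hcl hadj rank x n).and (eventually_ge_atTop N)).exists
  rw [dist_zero_right, norm_norm]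
  refine hm.trans_lt ?_
  rw [← dist_eq_norm]
  exact hN m hmN n hn

/-- The norm `‖·‖_q` is bounded by the sum of the weighted columns. Interpolation bounds each column
by its `ℓ₂` norm, which tends to zero, and dominated convergence handles the sum. -/
theorem tendsto_mul_partialSum (hA : ∀ x y : A, x * y = y * x)
    (hcl : IsClosed (A : Set SmoothOp)) (hadj : IsStarSubalgebra A)
    (rank : minimalProjections A ↪ ℕ) (x : A) :
    Tendsto (fun n => x * partialSum rank n) atTop (𝓝 x) := by
  rw [tendsto_subtype_rng, SmoothOp.withSeminorms.tendsto_nhds]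
  intro q
  have hproj := fun n => (isStarProjection_partialSum hA rank n).one_sub.norm_le
  set y : ℕ → A := fun n => x - x * partialSum rank n with hy
  have hW : ∀ n, ‖SmoothOp.weighted (2 * q) 0 (y n : SmoothOp)‖
      ≤ ‖SmoothOp.weighted (2 * q) 0 (x : SmoothOp)‖ := by
    intro n
    have h1 : SmoothOp.weighted (2 * q) 0 (y n : SmoothOp) =
        SmoothOp.weighted (2 * q) 0 (x : SmoothOp) * (1 - op (partialSum rank n)) := by
      ext1 η
      change S.toL2L (2 * q) ((x : SmoothOp).toCLM (SDual.ofL2L 0 η) -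
        (x : SmoothOp).toCLM (inclusion ((partialSum rank n : SmoothOp).toCLM (SDual.ofL2L 0 η))))
        = S.toL2L (2 * q) ((x : SmoothOp).toCLM (SDual.ofL2L 0 (η - op (partialSum rank n) η)))
      rw [map_sub (SDual.ofL2L 0), map_sub (x : SmoothOp).toCLM, inclusion_eq]
      rfl
    rw [h1]
    exact (norm_mul_le _ _).trans (mul_le_of_le_one_right (norm_nonneg _) (hproj n))
  have hye : ∀ n j, ‖op (y n) (unitVec j)‖ ≤ ‖op x (unitVec j)‖ := by
    intro n j
    have h1 : op (y n) (unitVec j) = (1 - op (partialSum rank n)) (op x (unitVec j)) := by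
      rw [hy, map_sub, hA x, sub_apply, op_mul_apply]
      rfl
    rw [h1]
    simpa using ContinuousLinearMap.le_of_opNorm_le _ (hproj n) (op x (unitVec j))
  set W := ‖SmoothOp.weighted (2 * q) 0 (x : SmoothOp)‖
  -- The square root of the decay `j^{-(2q+4)}` times the weight `j^q` leaves the summable `j^{-2}`.
  set R := ‖SmoothOp.weighted 0 (2 * q + 4) (x : SmoothOp)‖
  have hcol : ∀ n j, ‖SmoothOp.sandwich q (y n : SmoothOp) (unitVec j)‖ ≤
      ((j + 1 : ℕ) : ℝ) ^ q * √(W * ‖op (y n) (unitVec j)‖) := by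
    intro n j
    refine (SmoothOp.norm_sandwich_unitVec_le q j _).trans ?_
    gcongr
    · exact hW n
    · exact le_rfl
  have hdom : ∀ n j, ((j + 1 : ℕ) : ℝ) ^ q * √(W * ‖op (y n) (unitVec j)‖) ≤
      √(W * R) * (((j + 1 : ℕ) : ℝ) ^ 2)⁻¹ := by
    intro n j
    have hpos : (0 : ℝ) < ((j + 1 : ℕ) : ℝ) := by positivity
    have h1 : W * ‖op (y n) (unitVec j)‖ ≤ W * R / (((j + 1 : ℕ) : ℝ) ^ (q + 2)) ^ 2 := by
      rw [mul_div_assoc, ← pow_mul, show (q + 2) * 2 = 2 * q + 4 by ring]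
      gcongr
      exact (hye n j).trans (SmoothOp.norm_toL2_unitVec_le (2 * q + 4) j x)
    calc ((j + 1 : ℕ) : ℝ) ^ q * √(W * ‖op (y n) (unitVec j)‖)
        ≤ ((j + 1 : ℕ) : ℝ) ^ q * √(W * R / (((j + 1 : ℕ) : ℝ) ^ (q + 2)) ^ 2) := by gcongr
      _ = ((j + 1 : ℕ) : ℝ) ^ q * (√(W * R) / ((j + 1 : ℕ) : ℝ) ^ (q + 2)) := by
          rw [Real.sqrt_div' _ (by positivity), Real.sqrt_sq (by positivity)]
      _ = √(W * R) * (((j + 1 : ℕ) : ℝ) ^ 2)⁻¹ := by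
          rw [pow_add]
          field_simp
  have hs := SmoothOp.summable_inv_sq.mul_left √(W * R)
  have hlim := tendsto_tsum_of_dominated_convergence (𝓕 := atTop)
    (f := fun n j => ((j + 1 : ℕ) : ℝ) ^ q * √(W * ‖op (y n) (unitVec j)‖))
    (g := fun _ => (0 : ℝ)) hs (fun j => by
      have h1 : Tendsto (fun n => ‖op (y n) (unitVec j)‖) atTop (𝓝 0) := by
        refine squeeze_zero (fun _ => norm_nonneg _) (fun n => ?_)
          (tendsto_norm_op_sub hA hcl hadj rank x)
        have h2 := (op (y n)).le_opNorm (unitVec j)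
        rwa [norm_unitVec, mul_one] at h2
      have h2 := ((h1.const_mul W).sqrt).const_mul (((j + 1 : ℕ) : ℝ) ^ q)
      simpa using h2)
    (Eventually.of_forall fun n j => by
      rw [Real.norm_of_nonneg (by positivity)]; exact hdom n j)
  rw [tsum_zero] at hlim
  have hsum : ∀ n, Summable fun j => ((j + 1 : ℕ) : ℝ) ^ q * √(W * ‖op (y n) (unitVec j)‖) :=
    fun n => Summable.of_nonneg_of_le (fun _ => by positivity) (hdom n) hs
  intro ε hε
  filter_upwards [hlim.eventually (gt_mem_nhds hε)] with n hn
  refine lt_of_le_of_lt ?_ hn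
  have hcs := Summable.of_nonneg_of_le (fun _ => norm_nonneg _) (hcol n) (hsum n)
  calc SmoothOp.seminorms q (((x * partialSum rank n : A) : SmoothOp) - x)
      = ‖SmoothOp.sandwich q (y n : SmoothOp)‖ := by
        rw [map_sub_rev]; rfl
    _ ≤ ∑' j, ‖SmoothOp.sandwich q (y n : SmoothOp) (unitVec j)‖ := norm_le_tsum_columns _ hcs
    _ ≤ _ := hcs.tsum_le_tsum (hcol n) (hsum n)

/-! ### Coefficient functionals and uniqueness -/

/-- The coefficient of `x` at a minimal projection `P`. -/
noncomputable def coeff (P : minimalProjections A) : A →L[ℂ] ℂ where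
  toFun x := inner ℂ (minimalVec P) (op x (minimalVec P))
  map_add' x y := by rw [map_add, add_apply, inner_add_right]
  map_smul' c x := by rw [map_smul, smul_apply, inner_smul_right]; rfl
  cont := by
    have h : Continuous fun x : A => op x := SmoothOp.continuous_toL2.comp continuous_subtype_val
    exact continuous_const.inner (h.clm_apply continuous_const)

theorem coeff_apply_of_mul_eq_smul {P : minimalProjections A} {x : A} {c : ℂ}
    (h : x * P = c • (P : A)) : coeff P x = c := by
  have h1 : op x (minimalVec P) = c • minimalVec P := by
    have h2 := congrArg (fun y => op y (minimalVec P)) h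
    have h3 : op (P : A) (minimalVec P) = minimalVec P := apply_minimalVec P
    simpa only [op_mul_apply, map_smul, smul_apply, h3] using h2
  change inner ℂ (minimalVec P) (op x (minimalVec P)) = c
  rw [h1, inner_smul_right, inner_self_eq_norm_sq_to_K, norm_minimalVec]
  simp

theorem coeff_self (P : minimalProjections A) : coeff P (P : A) = 1 :=
  coeff_apply_of_mul_eq_smul (by rw [mul_self_of_mem_projections P.2.1, one_smul])

theorem coeff_of_ne (hA : ∀ x y : A, x * y = y * x) {P Q : minimalProjections A} (h : Q ≠ P) :
    coeff P (Q : A) = 0 :=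
  coeff_apply_of_mul_eq_smul (by
    rw [mul_eq_zero_of_minimal hA Q.2 P.2 fun h1 => h (Subtype.ext h1), zero_smul])

/-- Applied to the partial sums, the continuous functional `coeff P` is eventually constant with
value `c P`. -/
theorem IsExpansion.eq_coeff (hA : ∀ x y : A, x * y = y * x) {rank : minimalProjections A ↪ ℕ}
    {c : minimalProjections A → ℂ} {x : A}
    (h : IsExpansion rank (fun P : minimalProjections A => (P : A)) c x) :
    c = fun P => coeff P x := by
  classical
  funext P
  have h1 := ((coeff P).continuous.tendsto x).comp h
  refine tendsto_nhds_unique (tendsto_const_nhds.congr' ?_) h1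
  filter_upwards [eventually_gt_atTop (rank P)] with n hn
  rw [Function.comp_apply, map_sum, Finset.sum_eq_single_of_mem P (by simpa using hn)]
  · rw [map_smul, coeff_self, smul_eq_mul, mul_one]
  · intro Q _ hne
    rw [map_smul, coeff_of_ne hA hne, smul_zero]

theorem isExpansion_coeff (hA : ∀ x y : A, x * y = y * x)
    (hcl : IsClosed (A : Set SmoothOp)) (hadj : IsStarSubalgebra A)
    (rank : minimalProjections A ↪ ℕ) (x : A) :
    IsExpansion rank (fun P : minimalProjections A => (P : A)) (fun P => coeff P x) x := by
  refine (tendsto_mul_partialSum hA hcl hadj rank x).congr fun n => ?_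
  rw [partialSum, Finset.mul_sum]
  refine Finset.sum_congr rfl fun P _ => ?_
  obtain ⟨c, hc⟩ := exists_mul_minimal_eq_smul hA hcl hadj P.2 x
  change x * (P : A) = coeff P x • (P : A)
  rw [hc, coeff_apply_of_mul_eq_smul hc]

end SmoothOperators

theorem mainTheorem8 (A : NonUnitalSubalgebra ℂ SmoothOperators.SmoothOp)
    (hA : ∀ x ∈ A, ∀ y ∈ A, x * y = y * x) :
    ((SmoothOperators.minimalProjections A).Countable ∧
      (∀ P ∈ SmoothOperators.minimalProjections A, ∀ Q ∈ SmoothOperators.minimalProjections A,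
        P ≠ Q → P * Q = 0) ∧
      (∀ P ∈ SmoothOperators.projections A,
        ∃ F : Finset A, (F : Set A) ⊆ SmoothOperators.minimalProjections A ∧ P = ∑ Q ∈ F, Q)) ∧
    (IsClosed (A : Set SmoothOperators.SmoothOp) → SmoothOperators.IsStarSubalgebra A →
      ∀ rank : SmoothOperators.minimalProjections A ↪ ℕ,
        SmoothOperators.IsSchauderBasis rank
          (fun P : SmoothOperators.minimalProjections A => (P : A))) := by
  have hcomm : ∀ x y : A, x * y = y * x := fun x y => Subtype.ext (hA x x.2 y y.2)
  refine ⟨⟨SmoothOperators.countable_minimalProjections hcomm,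
    fun P hP Q hQ hne => SmoothOperators.mul_eq_zero_of_minimal hcomm hP hQ hne,
    fun P hP => SmoothOperators.exists_sum_minimal hcomm hP⟩, fun hcl hadj rank => ?_⟩
  have hexp := SmoothOperators.isExpansion_coeff hcomm hcl hadj rank
  exact ⟨fun x => ⟨_, hexp x, fun c hc => SmoothOperators.IsExpansion.eq_coeff hcomm hc⟩,
    SmoothOperators.coeff, hexp⟩
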